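/- Let $E$ be a $\sigma$-order complete (real) Banach lattice whose dual $E'$ has order continuous norm. Assume that $E$ has the Grothendieck property (GP): every weak$^*$ null sequence in $E'$ is weakly null. Then $E$ has the unbounded Grothendieck property (UGP) if and only if $E$ has order continuous norm. Here $E'$ carries its usual order ($f\le g$ iff $f(x)\le g(x)$ for all $x\ge 0$), and $E$ has the UGP if every norm bounded sequence $(x_n')$ in $E'$ with $x_n'\xrightarrow{uaw^*}0$ is weakly null, where $x_n'\xrightarrow{uaw^*}0$ means that $|x_n'|\wedge u'\to 0$ weak$^*$ for every $0\le u'\in E'$. The norm of a Banach lattice is order continuous if every decreasing net with infimum $0$ converges to $0$ in norm, and $E$ is $\sigma$-order complete if every nonempty countable subset of $E$ that is bounded above has a supremum. -/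

import Mathlib

open Filter Topology

namespace BanachLattice

/-! ### The dual of a Banach lattice as a vector lattice -/

section Dual

variable {E : Type*} [NormedAddCommGroup E] [NormedSpace ℝ E] [Lattice E]
  [IsOrderedAddMonoid E] [HasSolidNorm E]

/-- For `0 ≤ x`, the value at `x` of the positive part of the functional `f`:
the supremum of `f y` over `0 ≤ y ≤ x`. -/
noncomputable def posPartCone (f : StrongDual ℝ E) (x : E) : ℝ := sSup (f '' Set.Icc 0 x)

theorem apply_le_of_mem_Icc (f : StrongDual ℝ E) {x y : E} (hy : y ∈ Set.Icc 0 x) :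
    f y ≤ ‖f‖ * ‖x‖ := by
  have h1 : ‖y‖ ≤ ‖x‖ := by
    apply norm_le_norm_of_abs_le_abs
    rw [abs_of_nonneg hy.1, abs_of_nonneg (hy.1.trans hy.2)]
    exact hy.2
  calc f y ≤ ‖f y‖ := Real.le_norm_self _
    _ ≤ ‖f‖ * ‖y‖ := f.le_opNorm y
    _ ≤ ‖f‖ * ‖x‖ := by gcongr

theorem bddAbove_image_Icc (f : StrongDual ℝ E) (x : E) : BddAbove (f '' Set.Icc 0 x) := by
  refine ⟨‖f‖ * ‖x‖, ?_⟩
  rintro _ ⟨y, hy, rfl⟩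
  exact apply_le_of_mem_Icc f hy

theorem le_posPartCone (f : StrongDual ℝ E) {x y : E} (hy : y ∈ Set.Icc 0 x) :
    f y ≤ posPartCone f x :=
  le_csSup (bddAbove_image_Icc f x) ⟨y, hy, rfl⟩

theorem posPartCone_le (f : StrongDual ℝ E) {x : E} (hx : 0 ≤ x) {c : ℝ}
    (h : ∀ y ∈ Set.Icc 0 x, f y ≤ c) : posPartCone f x ≤ c := by
  refine csSup_le ⟨f 0, 0, ⟨le_rfl, hx⟩, rfl⟩ ?_
  rintro _ ⟨y, hy, rfl⟩
  exact h y hy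

theorem posPartCone_nonneg (f : StrongDual ℝ E) {x : E} (hx : 0 ≤ x) : 0 ≤ posPartCone f x := by
  simpa using le_posPartCone f (x := x) (y := 0) ⟨le_rfl, hx⟩

theorem posPartCone_zero (f : StrongDual ℝ E) : posPartCone f 0 = 0 := by
  simp [posPartCone]

theorem posPartCone_add (f : StrongDual ℝ E) {x z : E} (hx : 0 ≤ x) (hz : 0 ≤ z) :
    posPartCone f (x + z) = posPartCone f x + posPartCone f z := by
  apply le_antisymm
  · refine posPartCone_le f (add_nonneg hx hz) fun y hy => ?_
    have h1 : y ⊓ x ∈ Set.Icc 0 x := ⟨le_inf hy.1 hx, inf_le_right⟩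
    have h2 : y - y ⊓ x ∈ Set.Icc 0 z := by
      refine ⟨sub_nonneg.2 inf_le_left, ?_⟩
      rw [sub_le_iff_le_add', ← sub_le_iff_le_add]
      exact le_inf (sub_le_self _ hz) (sub_le_iff_le_add.2 hy.2)
    have := add_le_add (le_posPartCone f h1) (le_posPartCone f h2)
    rwa [← map_add, add_sub_cancel] at this
  · rw [← le_sub_iff_add_le]
    refine posPartCone_le f hx fun y hy => ?_
    rw [le_sub_comm]
    refine posPartCone_le f hz fun w hw => ?_
    rw [le_sub_iff_add_le', ← map_add]
    exact le_posPartCone f ⟨add_nonneg hy.1 hw.1, add_le_add hy.2 hw.2⟩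

/-- The positive part of `f`, as an additive map: `x ↦ f⁺ (x⁺) - f⁺ (x⁻)`. -/
noncomputable def posPartHom (f : StrongDual ℝ E) : E →+ ℝ where
  toFun x := posPartCone f x⁺ - posPartCone f x⁻
  map_zero' := by simp [posPartCone_zero]
  map_add' x y := by
    have h : (x + y)⁺ + (x⁻ + y⁻) = (x⁺ + y⁺) + (x + y)⁻ := by
      have h1 := posPart_sub_negPart (x + y)
      have h2 := posPart_sub_negPart x
      have h3 := posPart_sub_negPart y
      rw [← sub_eq_zero]
      calc _ = ((x + y)⁺ - (x + y)⁻) - (x⁺ - x⁻) - (y⁺ - y⁻) := by abel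
        _ = 0 := by rw [h1, h2, h3]; abel
    have h' := congrArg (posPartCone f) h
    rw [posPartCone_add f (posPart_nonneg _) (add_nonneg (negPart_nonneg _) (negPart_nonneg _)),
      posPartCone_add f (negPart_nonneg _) (negPart_nonneg _),
      posPartCone_add f (add_nonneg (posPart_nonneg _) (posPart_nonneg _)) (negPart_nonneg _),
      posPartCone_add f (posPart_nonneg _) (posPart_nonneg _)] at h'
    linarith

theorem posPartHom_apply_of_nonneg (f : StrongDual ℝ E) {x : E} (hx : 0 ≤ x) :
    posPartHom f x = posPartCone f x := by
  simp [posPartHom, posPart_of_nonneg hx, negPart_of_nonneg hx, posPartCone_zero]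

theorem norm_posPartHom_le (f : StrongDual ℝ E) (x : E) : ‖posPartHom f x‖ ≤ ‖f‖ * ‖x‖ := by
  have hp : ‖x⁺‖ ≤ ‖x‖ := by
    apply norm_le_norm_of_abs_le_abs
    rw [abs_of_nonneg (posPart_nonneg x)]
    exact sup_le (le_abs_self x) (abs_nonneg x)
  have hn : ‖x⁻‖ ≤ ‖x‖ := by
    apply norm_le_norm_of_abs_le_abs
    rw [abs_of_nonneg (negPart_nonneg x)]
    exact sup_le (neg_le_abs x) (abs_nonneg x)
  have h1 : posPartCone f x⁺ ≤ ‖f‖ * ‖x‖ :=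
    posPartCone_le f (posPart_nonneg x) fun y hy =>
      (apply_le_of_mem_Icc f hy).trans (by gcongr)
  have h2 : posPartCone f x⁻ ≤ ‖f‖ * ‖x‖ :=
    posPartCone_le f (negPart_nonneg x) fun y hy =>
      (apply_le_of_mem_Icc f hy).trans (by gcongr)
  have h3 := posPartCone_nonneg f (posPart_nonneg x)
  have h4 := posPartCone_nonneg f (negPart_nonneg x)
  change |posPartCone f x⁺ - posPartCone f x⁻| ≤ _
  rw [abs_le]
  constructor <;> linarith

/-- The positive part of a continuous functional on a normed lattice. -/
noncomputable def dualPosPart (f : StrongDual ℝ E) : StrongDual ℝ E :=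
  (posPartHom f).toRealLinearMap
    (AddMonoidHomClass.continuous_of_bound (posPartHom f) ‖f‖ (norm_posPartHom_le f))

theorem dualPosPart_apply_of_nonneg (f : StrongDual ℝ E) {x : E} (hx : 0 ≤ x) :
    dualPosPart f x = posPartCone f x :=
  posPartHom_apply_of_nonneg f hx

/-- The topological dual of a normed lattice, with the usual order (`f ≤ g` if and only if
`f x ≤ g x` for all `0 ≤ x`) and the lattice operations of this order. -/
noncomputable instance dualLattice : Lattice (StrongDual ℝ E) where
  le f g := ∀ x : E, 0 ≤ x → f x ≤ g x
  le_refl _ _ _ := le_rfl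
  le_trans _ _ _ h h' x hx := (h x hx).trans (h' x hx)
  le_antisymm f g h h' := by
    ext x
    have hp := le_antisymm (h _ (posPart_nonneg x)) (h' _ (posPart_nonneg x))
    have hn := le_antisymm (h _ (negPart_nonneg x)) (h' _ (negPart_nonneg x))
    rw [← posPart_sub_negPart x, map_sub, map_sub, hp, hn]
  sup f g := f + dualPosPart (g - f)
  inf f g := f - dualPosPart (f - g)
  le_sup_left f g x hx := by
    have := posPartCone_nonneg (g - f) hx
    rw [ContinuousLinearMap.add_apply, dualPosPart_apply_of_nonneg _ hx]
    linarith
  le_sup_right f g x hx := by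
    have := le_posPartCone (g - f) (x := x) (y := x) ⟨hx, le_rfl⟩
    rw [ContinuousLinearMap.sub_apply] at this
    rw [ContinuousLinearMap.add_apply, dualPosPart_apply_of_nonneg _ hx]
    linarith
  sup_le f g k hf hg x hx := by
    rw [ContinuousLinearMap.add_apply, dualPosPart_apply_of_nonneg _ hx, ← le_sub_iff_add_le']
    refine posPartCone_le _ hx fun y hy => ?_
    have h1 := hg y hy.1
    have h2 := hf (x - y) (sub_nonneg.2 hy.2)
    rw [map_sub, map_sub] at h2
    rw [ContinuousLinearMap.sub_apply]
    linarith
  inf_le_left f g x hx := by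
    have := posPartCone_nonneg (f - g) hx
    rw [ContinuousLinearMap.sub_apply, dualPosPart_apply_of_nonneg _ hx]
    linarith
  inf_le_right f g x hx := by
    have := le_posPartCone (f - g) (x := x) (y := x) ⟨hx, le_rfl⟩
    rw [ContinuousLinearMap.sub_apply] at this
    rw [ContinuousLinearMap.sub_apply, dualPosPart_apply_of_nonneg _ hx]
    linarith
  le_inf k f g hf hg x hx := by
    rw [ContinuousLinearMap.sub_apply, dualPosPart_apply_of_nonneg _ hx, le_sub_comm]
    refine posPartCone_le _ hx fun y hy => ?_
    have h1 := hg y hy.1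
    have h2 := hf (x - y) (sub_nonneg.2 hy.2)
    rw [map_sub, map_sub] at h2
    rw [ContinuousLinearMap.sub_apply]
    linarith

end Dual

/-! ### Order completeness and order continuity -/

/-- `σ`-order completeness: every nonempty countable set that is bounded above has a supremum. -/
def SigmaOrderComplete (E : Type*) [Lattice E] : Prop :=
  ∀ s : Set E, s.Countable → s.Nonempty → BddAbove s → ∃ a, IsLUB s a

/-- Order continuity of the norm: every downward directed set (decreasing net) with infimum `0`,
indexed by itself, converges to `0` in norm. -/
def OrderContinuous (E : Type*) [NormedAddCommGroup E] [Lattice E] : Prop :=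
  ∀ s : Set E, s.Nonempty → DirectedOn (· ≥ ·) s → IsGLB s 0 →
    ∀ ε : ℝ, 0 < ε → ∃ x ∈ s, ∀ y ∈ s, y ≤ x → ‖y‖ < ε

/-! ### Convergence of sequences of functionals and Grothendieck properties -/

section Convergence

variable {E : Type*} [NormedAddCommGroup E] [NormedSpace ℝ E]

/-- Weak* convergence in the dual `E'` of `E`. -/
def WeakStarTendsto (f : ℕ → StrongDual ℝ E) (g : StrongDual ℝ E) : Prop :=
  Tendsto (fun n => StrongDual.toWeakDual (f n)) atTop (𝓝 (StrongDual.toWeakDual g))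

/-- Convergence in the weak topology of the Banach space `E'`. -/
def WeakTendsto (f : ℕ → StrongDual ℝ E) (g : StrongDual ℝ E) : Prop :=
  Tendsto (fun n => toWeakSpace ℝ (StrongDual ℝ E) (f n)) atTop
    (𝓝 (toWeakSpace ℝ (StrongDual ℝ E) g))

/-- Unbounded absolute weak* convergence (`uaw*`): `|f n - g| ⊓ u` is weak* null for every
positive functional `u`. -/
def UnboundedWeakStarTendsto [Lattice E] [IsOrderedAddMonoid E] [HasSolidNorm E]
    (f : ℕ → StrongDual ℝ E) (g : StrongDual ℝ E) : Prop :=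
  ∀ u : StrongDual ℝ E, 0 ≤ u → WeakStarTendsto (fun n => |f n - g| ⊓ u) 0

end Convergence

/-- The Grothendieck property (GP). -/
def GrothendieckProperty (E : Type*) [NormedAddCommGroup E] [NormedSpace ℝ E] : Prop :=
  ∀ f : ℕ → StrongDual ℝ E, WeakStarTendsto f 0 → WeakTendsto f 0

/-- The unbounded Grothendieck property (UGP). -/
def UnboundedGrothendieckProperty (E : Type*) [NormedAddCommGroup E] [NormedSpace ℝ E]
    [Lattice E] [IsOrderedAddMonoid E] [HasSolidNorm E] : Prop :=
  ∀ f : ℕ → StrongDual ℝ E, (∃ C : ℝ, ∀ n, ‖f n‖ ≤ C) → UnboundedWeakStarTendsto f 0 →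
    WeakTendsto f 0

end BanachLattice

namespace BanachLattice

/-! ### Positive functionals, and the part of one carried by a vector. -/

section Dual

variable {E : Type*} [NormedAddCommGroup E] [NormedSpace ℝ E] [Lattice E]
  [IsOrderedAddMonoid E] [HasSolidNorm E]

/-! UGP forces order continuity: otherwise some series `∑ d n` of positive vectors has partial sums
below `x` and `‖d n‖ ≥ ε` (`orderContinuous_of_forall_sum_le`). For large `c` the vectors `w n = (c
• d n - x)⁺` have norm at least `1`; take norming positive functionals and keep only their parts `f
n` carried by `w n` (`exists_carried_part`). Then `f n` vanishes on `(x - c • d n)⁺`, so `(f n ⊓ u)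
x ≤ c * u (d n) → 0`, and `f n` is `uaw*`-null (`unboundedWeakStarTendsto_of_carried`). Yet `f n (c
• x) ≥ 1`, so it is not weakly null.

Conversely, by GP it is enough that bounded `uaw*`-null sequences are weak* null. If `|f n| x` does
not tend to `0`, a gliding hump yields a subsequence and `y k ∈ [0, x]` such that the `k`-th
functional is at least `ε / 2` at `y k` while all earlier ones are tiny there. The tail suprema of
`y` decrease to a vector at which no chosen functional is positive; norm convergence to it makes the
values at `y k` small (`OrderContinuous.exists_apply_lt`). -/

theorem apply_nonneg {f : StrongDual ℝ E} (hf : 0 ≤ f) {x : E} (hx : 0 ≤ x) : 0 ≤ f x := by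
  simpa using hf x hx

theorem apply_mono {f : StrongDual ℝ E} (hf : 0 ≤ f) {x y : E} (h : x ≤ y) : f x ≤ f y := by
  have := apply_nonneg hf (sub_nonneg.2 h)
  rw [map_sub] at this
  linarith

theorem dualPosPart_nonneg (f : StrongDual ℝ E) : 0 ≤ dualPosPart f := fun x hx => by
  rw [dualPosPart_apply_of_nonneg f hx]
  exact posPartCone_nonneg f hx

theorem norm_dualPosPart_le (f : StrongDual ℝ E) : ‖dualPosPart f‖ ≤ ‖f‖ :=
  ContinuousLinearMap.opNorm_le_bound _ (norm_nonneg f) (norm_posPartHom_le f)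

theorem abs_of_dual_nonneg {f : StrongDual ℝ E} (hf : 0 ≤ f) : |f| = f := by
  refine sup_eq_left.2 fun x hx => ?_
  have := apply_nonneg hf hx
  rw [neg_apply]
  linarith

theorem dual_abs_nonneg (f : StrongDual ℝ E) : 0 ≤ |f| := fun x hx => by
  have h1 : f x ≤ |f| x := (le_sup_left : f ≤ f ⊔ -f) x hx
  have h2 : (-f) x ≤ |f| x := (le_sup_right : -f ≤ f ⊔ -f) x hx
  rw [neg_apply] at h2
  rw [zero_apply]
  linarith

theorem abs_apply_le (f : StrongDual ℝ E) {x : E} (hx : 0 ≤ x) : |f x| ≤ |f| x := by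
  have h1 : f x ≤ |f| x := (le_sup_left : f ≤ f ⊔ -f) x hx
  have h2 : (-f) x ≤ |f| x := (le_sup_right : -f ≤ f ⊔ -f) x hx
  rw [neg_apply] at h2
  exact abs_le.2 ⟨by linarith, h1⟩

/-- Here `|f| = f + (-2f)⁺`. The constant is crude, but only boundedness matters. -/
theorem norm_dual_abs_le (f : StrongDual ℝ E) : ‖|f|‖ ≤ 3 * ‖f‖ := by
  change ‖f + dualPosPart (-f - f)‖ ≤ _
  have h := norm_dualPosPart_le (-f - f)
  have h1 := norm_sub_le (-f) f
  rw [norm_neg] at h1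
  have h2 := norm_add_le f (dualPosPart (-f - f))
  linarith

theorem dual_inf_nonneg {f u : StrongDual ℝ E} (hf : 0 ≤ f) (hu : 0 ≤ u) : 0 ≤ f ⊓ u :=
  le_inf hf hu

/-- The Riesz-Kantorovich formula for the infimum of two functionals. -/
theorem exists_lt_of_inf_apply_lt {f g : StrongDual ℝ E} {x : E} (hx : 0 ≤ x) {c : ℝ}
    (h : (f ⊓ g) x < c) : ∃ y ∈ Set.Icc 0 x, f (x - y) + g y < c := by
  by_contra! H
  have : posPartCone (f - g) x ≤ f x - c := posPartCone_le _ hx fun y hy => by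
    have := H y hy
    rw [map_sub] at this
    rw [sub_apply]
    linarith
  change (f - dualPosPart (f - g)) x < c at h
  rw [sub_apply, dualPosPart_apply_of_nonneg _ hx] at h
  linarith

theorem exists_dual_nonneg_norm_le (x : E) :
    ∃ f : StrongDual ℝ E, 0 ≤ f ∧ ‖f‖ ≤ 1 ∧ (0 ≤ x → ‖x‖ ≤ f x) := by
  obtain ⟨g, hg, hgx⟩ := exists_dual_vector'' ℝ x
  refine ⟨dualPosPart g, dualPosPart_nonneg g, (norm_dualPosPart_le g).trans hg, fun hx => ?_⟩
  rw [dualPosPart_apply_of_nonneg g hx]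
  calc ‖x‖ = g x := by rw [hgx]; rfl
    _ ≤ _ := le_posPartCone g ⟨hx, le_rfl⟩

/-- A bounded nonnegative additive function on the positive cone extends to a continuous
functional. -/
theorem exists_dual_eqOn_cone (r : E → ℝ) {C : ℝ}
    (hadd : ∀ x y : E, 0 ≤ x → 0 ≤ y → r (x + y) = r x + r y)
    (h0 : ∀ x : E, 0 ≤ x → 0 ≤ r x) (hC : 0 ≤ C) (hr : ∀ x : E, 0 ≤ x → r x ≤ C * ‖x‖) :
    ∃ f : StrongDual ℝ E, 0 ≤ f ∧ ‖f‖ ≤ C ∧ ∀ x : E, 0 ≤ x → f x = r x := by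
  have hr0 : r 0 = 0 := by
    have := hadd 0 0 le_rfl le_rfl
    rw [add_zero] at this
    linarith
  let F : E →+ ℝ :=
    { toFun x := r x⁺ - r x⁻
      map_zero' := by simp
      map_add' x y := by
        have h : (x + y)⁺ + (x⁻ + y⁻) = (x⁺ + y⁺) + (x + y)⁻ := by
          have h1 := posPart_sub_negPart (x + y)
          have h2 := posPart_sub_negPart x
          have h3 := posPart_sub_negPart y
          rw [← sub_eq_zero]
          calc _ = ((x + y)⁺ - (x + y)⁻) - (x⁺ - x⁻) - (y⁺ - y⁻) := by abel
            _ = 0 := by rw [h1, h2, h3]; abel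
        have h' := congrArg r h
        rw [hadd _ _ (posPart_nonneg _) (add_nonneg (negPart_nonneg _) (negPart_nonneg _)),
          hadd _ _ (negPart_nonneg _) (negPart_nonneg _),
          hadd _ _ (add_nonneg (posPart_nonneg _) (posPart_nonneg _)) (negPart_nonneg _),
          hadd _ _ (posPart_nonneg _) (posPart_nonneg _)] at h'
        linarith }
  have hF : ∀ x : E, 0 ≤ x → F x = r x := fun x hx => by
    change r x⁺ - r x⁻ = r x
    rw [posPart_of_nonneg hx, negPart_of_nonneg hx, hr0, sub_zero]
  have hb : ∀ x : E, ‖F x‖ ≤ C * ‖x‖ := fun x => by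
    have hp : ‖x⁺‖ ≤ ‖x‖ := by
      apply norm_le_norm_of_abs_le_abs
      rw [abs_of_nonneg (posPart_nonneg x)]
      exact sup_le (le_abs_self x) (abs_nonneg x)
    have hn : ‖x⁻‖ ≤ ‖x‖ := by
      apply norm_le_norm_of_abs_le_abs
      rw [abs_of_nonneg (negPart_nonneg x)]
      exact sup_le (neg_le_abs x) (abs_nonneg x)
    have h1 := (hr _ (posPart_nonneg x)).trans (mul_le_mul_of_nonneg_left hp hC)
    have h2 := (hr _ (negPart_nonneg x)).trans (mul_le_mul_of_nonneg_left hn hC)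
    have h3 := h0 _ (posPart_nonneg x)
    have h4 := h0 _ (negPart_nonneg x)
    change |r x⁺ - r x⁻| ≤ _
    exact abs_le.2 ⟨by linarith, by linarith⟩
  refine ⟨F.toRealLinearMap (AddMonoidHomClass.continuous_of_bound F C hb), fun x hx => ?_,
    ContinuousLinearMap.opNorm_le_bound _ hC hb, hF⟩
  exact (h0 x hx).trans_eq (hF x hx).symm

theorem add_inf_le_inf_add_inf {x y b : E} (hx : 0 ≤ x) (hy : 0 ≤ y) (hb : 0 ≤ b) :
    (x + y) ⊓ b ≤ x ⊓ b + y ⊓ b := by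
  rw [add_inf, inf_add, inf_add]
  refine le_inf (le_inf inf_le_left ?_) (le_inf ?_ ?_)
  · exact inf_le_right.trans (le_add_of_nonneg_right hy)
  · exact inf_le_right.trans (le_add_of_nonneg_left hx)
  · exact inf_le_right.trans (le_add_of_nonneg_left hb)

theorem inf_nsmul_eq_zero {a w : E} (ha : 0 ≤ a) (hw : 0 ≤ w) (h : a ⊓ w = 0) (k : ℕ) :
    a ⊓ k • w = 0 := by
  induction k with
  | zero => rw [zero_nsmul, inf_eq_right.2 ha]
  | succ k ih =>
    refine le_antisymm ?_ (le_inf ha (nsmul_nonneg hw _))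
    rw [succ_nsmul, inf_comm]
    refine (add_inf_le_inf_add_inf (nsmul_nonneg hw k) hw ha).trans ?_
    rw [inf_comm, ih, inf_comm, h, add_zero]

/-- The component of a positive functional `f` in the band of functionals carried by `w`: on the
positive cone it is the limit of `f (y ⊓ k • w)`. -/
theorem exists_carried_part {f : StrongDual ℝ E} (hf : 0 ≤ f) {w : E} (hw : 0 ≤ w) :
    ∃ g : StrongDual ℝ E, 0 ≤ g ∧ ‖g‖ ≤ ‖f‖ ∧
      (∀ y : E, 0 ≤ y → ∀ k : ℕ, f (y ⊓ k • w) ≤ g y) ∧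
      ∀ y : E, 0 ≤ y → Tendsto (fun k : ℕ => f (y ⊓ k • w)) atTop (𝓝 (g y)) := by
  have hkw : ∀ k : ℕ, 0 ≤ k • w := fun k => nsmul_nonneg hw k
  have hmono : ∀ y : E, Monotone fun k : ℕ => f (y ⊓ k • w) := fun y i j hij =>
    apply_mono hf (inf_le_inf_left y (nsmul_le_nsmul_left hw hij))
  have hbd : ∀ y : E, 0 ≤ y → ∀ k : ℕ, f (y ⊓ k • w) ≤ ‖f‖ * ‖y‖ := fun y hy k =>
    apply_le_of_mem_Icc f ⟨le_inf hy (hkw k), inf_le_left⟩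
  have hbdd : ∀ y : E, 0 ≤ y → BddAbove (Set.range fun k : ℕ => f (y ⊓ k • w)) := fun y hy =>
    ⟨‖f‖ * ‖y‖, by rintro _ ⟨k, rfl⟩; exact hbd y hy k⟩
  have hlim : ∀ y : E, 0 ≤ y →
      Tendsto (fun k : ℕ => f (y ⊓ k • w)) atTop (𝓝 (⨆ k : ℕ, f (y ⊓ k • w))) := fun y hy =>
    tendsto_atTop_ciSup (hmono y) (hbdd y hy)
  obtain ⟨g, hg, hgf, hgr⟩ := exists_dual_eqOn_cone (fun y => ⨆ k : ℕ, f (y ⊓ k • w)) (C := ‖f‖)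
    (fun x y hx hy => by
      apply le_antisymm
      · refine le_of_tendsto_of_tendsto' (hlim _ (add_nonneg hx hy))
          ((hlim x hx).add (hlim y hy)) fun k => ?_
        rw [← map_add]
        exact apply_mono hf (add_inf_le_inf_add_inf hx hy (hkw k))
      · refine le_of_tendsto' ((hlim x hx).add (hlim y hy)) fun k => ?_
        -- Doubling the index absorbs the sum: `x ⊓ k • w + y ⊓ k • w ≤ (x + y) ⊓ (k + k) • w`.
        refine le_trans ?_ (le_ciSup (hbdd _ (add_nonneg hx hy)) (k + k))
        rw [← map_add, add_nsmul]
        exact apply_mono hf (le_inf (add_le_add inf_le_left inf_le_left)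
          (add_le_add inf_le_right inf_le_right)))
    (fun x hx => ge_of_tendsto' (hlim x hx) fun k => apply_nonneg hf (le_inf hx (hkw k)))
    (norm_nonneg f) (fun x hx => le_of_tendsto' (hlim x hx) (hbd x hx))
  refine ⟨g, hg, hgf, fun y hy k => ?_, fun y hy => ?_⟩
  · rw [hgr y hy]
    exact le_ciSup (hbdd y hy) k
  · rw [hgr y hy]
    exact hlim y hy

end Dual

/-! ### Weak and weak* null sequences tested at vectors. -/

section Convergence

variable {E : Type*} [NormedAddCommGroup E] [NormedSpace ℝ E]

theorem weakStarTendsto_zero_iff {f : ℕ → StrongDual ℝ E} :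
    WeakStarTendsto f 0 ↔ ∀ x, Tendsto (fun n => f n x) atTop (𝓝 0) := by
  rw [WeakStarTendsto, tendsto_iff_forall_eval_tendsto_topDualPairing]
  rfl

theorem WeakTendsto.apply {f : ℕ → StrongDual ℝ E} (h : WeakTendsto f 0) (x : E) :
    Tendsto (fun n => f n x) atTop (𝓝 0) := by
  have h1 := (WeakBilin.eval_continuous (topDualPairing ℝ (StrongDual ℝ E)).flip
    (ContinuousLinearMap.apply ℝ ℝ x)).tendsto (toWeakSpace ℝ (StrongDual ℝ E) 0)
  exact h1.comp h

end Convergence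

/-! ### A series criterion for order continuity of the norm. -/

section Main

variable {E : Type*} [NormedAddCommGroup E] [NormedSpace ℝ E] [Lattice E]
  [IsOrderedAddMonoid E] [HasSolidNorm E]

theorem norm_le_norm_of_nonneg_of_le {x y : E} (hx : 0 ≤ x) (h : x ≤ y) : ‖x‖ ≤ ‖y‖ := by
  apply norm_le_norm_of_abs_le_abs
  rwa [abs_of_nonneg hx, abs_of_nonneg (hx.trans h)]

theorem OrderContinuous.tendsto_norm (hE : OrderContinuous E) {a : ℕ → E} (ha : Antitone a)
    (h0 : IsGLB (Set.range a) 0) : Tendsto (fun n => ‖a n‖) atTop (𝓝 0) := by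
  rw [Metric.tendsto_atTop]
  intro ε hε
  obtain ⟨_, ⟨n, rfl⟩, hn⟩ := hE (Set.range a) (Set.range_nonempty a)
    (by
      rintro _ ⟨i, rfl⟩ _ ⟨j, rfl⟩
      exact ⟨_, ⟨max i j, rfl⟩, ha (le_max_left i j), ha (le_max_right i j)⟩) h0 ε hε
  refine ⟨n, fun m hm => ?_⟩
  rw [Real.dist_eq, sub_zero, abs_of_nonneg (norm_nonneg _)]
  exact hn _ ⟨m, rfl⟩ (ha hm)

/-- If order bounded series in `E` have null terms, then the norm of `E` is order continuous. -/
theorem orderContinuous_of_forall_sum_le [CompleteSpace E]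
    (h : ∀ (x : E) (d : ℕ → E) (ε : ℝ), 0 < ε → (∀ n, 0 ≤ d n) →
      (∀ n, ∑ i ∈ Finset.range n, d i ≤ x) → ∃ n, ‖d n‖ < ε) : OrderContinuous E := by
  intro s hs hdir hglb ε hε
  have hs0 : ∀ x ∈ s, 0 ≤ x := fun x hx => hglb.1 hx
  -- The net is Cauchy: otherwise iterating a choice of jumps of norm at least `δ` gives a
  -- telescoping series bounded by `a`.
  have key : ∀ δ : ℝ, 0 < δ → ∀ a ∈ s, ∃ x ∈ s, x ≤ a ∧ ∀ y ∈ s, y ≤ x → ‖x - y‖ < δ := by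
    by_contra! H
    obtain ⟨δ, hδ, a, ha, H⟩ := H
    choose! g hg using H
    let b : ℕ → E := fun n => g^[n] a
    have hb1 : ∀ n, b (n + 1) = g (b n) := fun n => Function.iterate_succ_apply' g n a
    have hb : ∀ n, b n ∈ s ∧ b n ≤ a := by
      intro n
      induction n with
      | zero => exact ⟨ha, le_rfl⟩
      | succ n ih =>
        rw [hb1]
        have := hg (b n) ih.1 ih.2
        exact ⟨this.1, this.2.1.trans ih.2⟩
    obtain ⟨n, hn⟩ := h a (fun n => b n - b (n + 1)) δ hδ
      (fun n => by rw [hb1]; exact sub_nonneg.2 (hg (b n) (hb n).1 (hb n).2).2.1)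
      (fun n => by
        rw [Finset.sum_range_sub']
        exact sub_le_self _ (hs0 _ (hb n).1))
    rw [hb1] at hn
    exact absurd hn (not_lt.2 (hg (b n) (hb n).1 (hb n).2).2.2)
  obtain ⟨a, ha⟩ := hs
  choose! g hg using fun n : ℕ => key ((1 / 2) ^ n) (by positivity)
  let b : ℕ → E := fun n => Nat.rec (g 0 a) (fun k y => g (k + 1) y) n
  have hbs : ∀ n, b n ∈ s := by
    intro n
    induction n with
    | zero => exact (hg 0 a ha).1
    | succ n ih => exact (hg (n + 1) (b n) ih).1
  have hb : ∀ n, ∀ y ∈ s, y ≤ b n → ‖b n - y‖ < (1 / 2) ^ n := by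
    intro n
    cases n with
    | zero => exact (hg 0 a ha).2.2
    | succ n => exact (hg (n + 1) (b n) (hbs n)).2.2
  have hanti : Antitone b := antitone_nat_of_succ_le fun n => (hg (n + 1) (b n) (hbs n)).2.1
  have hcau : CauchySeq b := by
    refine cauchySeq_of_le_geometric (1 / 2) 1 (by norm_num) fun n => ?_
    rw [dist_eq_norm, one_mul]
    exact (hb n _ (hbs _) (hanti n.le_succ)).le
  obtain ⟨l, hl⟩ := cauchySeq_tendsto_of_complete hcau
  have hl0 : l = 0 := by
    apply le_antisymm
    · refine hglb.2 fun y hy => ?_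
      -- A common lower bound `c n` of `b n` and `y` is within `(1 / 2) ^ n` of `b n`, so `c n → l`
      -- and hence `l ≤ y`.
      choose c hcs hcb hcy using fun n => hdir (b n) (hbs n) y hy
      have hc : Tendsto (fun n => b n - c n) atTop (𝓝 0) :=
        squeeze_zero_norm (fun n => (hb n (c n) (hcs n) (hcb n)).le)
          (tendsto_pow_atTop_nhds_zero_of_lt_one (by norm_num) (by norm_num))
      have hc' := hl.sub hc
      rw [sub_zero] at hc'
      exact le_of_tendsto' hc' fun n => by simpa using hcy n
    · exact ge_of_tendsto' hl fun n => hs0 _ (hbs n)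
  rw [hl0] at hl
  obtain ⟨n, hn⟩ := (hl.norm.eventually_lt_const (by simpa using hε)).exists
  exact ⟨b n, hbs n, fun y hy hyn => (norm_le_norm_of_nonneg_of_le (hs0 y hy) hyn).trans_lt hn⟩

/-! ### UGP implies order continuity. -/

/-- Functionals carried by the sets where `c • d n` exceeds `x`, with an order bounded series
`∑ d n`, are `uaw*`-null. -/
theorem unboundedWeakStarTendsto_of_carried {x : E} (hx : 0 ≤ x) {d : ℕ → E} (hd : ∀ n, 0 ≤ d n)
    (hsum : ∀ n, ∑ i ∈ Finset.range n, d i ≤ x) (c : ℕ) {φ f : ℕ → StrongDual ℝ E}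
    (hf : ∀ n, 0 ≤ f n)
    (hlim : ∀ n, ∀ y : E, 0 ≤ y →
      Tendsto (fun k : ℕ => φ n (y ⊓ k • (c • d n - x)⁺)) atTop (𝓝 (f n y)))
    (hle : ∀ n, ∀ y : E, 0 ≤ y → ∀ k : ℕ, φ n (y ⊓ k • (c • d n - x)⁺) ≤ f n y) :
    UnboundedWeakStarTendsto f 0 := by
  intro u hu
  have habs : ∀ n, |f n - 0| ⊓ u = f n ⊓ u := fun n => by
    rw [sub_zero, abs_of_dual_nonneg (hf n)]
  simp only [habs]
  rw [weakStarTendsto_zero_iff]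
  have hv : ∀ n, 0 ≤ f n ⊓ u := fun n => dual_inf_nonneg (hf n) hu
  have hvf : ∀ n, ∀ y : E, 0 ≤ y → (f n ⊓ u) y ≤ f n y := fun n => (inf_le_left : f n ⊓ u ≤ f n)
  have hvu : ∀ n, ∀ y : E, 0 ≤ y → (f n ⊓ u) y ≤ u y := fun n => (inf_le_right : f n ⊓ u ≤ u)
  have hdx : ∀ n, d n ≤ x := fun n => by
    refine le_trans ?_ (hsum (n + 1))
    exact Finset.single_le_sum (fun i _ => hd i) (Finset.self_mem_range_succ n)
  have hud : Tendsto (fun n => u (d n)) atTop (𝓝 0) := by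
    refine (summable_of_sum_range_le (c := u x) (fun n => apply_nonneg hu (hd n))
      fun n => ?_).tendsto_atTop_zero
    rw [← map_sum]
    exact apply_mono hu (hsum n)
  -- Split `x` at `c • d n`: the excess `(x - c • d n)⁺` is disjoint from `(c • d n - x)⁺`, so `f n`
  -- kills it, and `u` controls the rest.
  have hvx : ∀ n, (f n ⊓ u) x ≤ c * u (d n) := by
    intro n
    have h1 : x = x ⊓ c • d n + (x - c • d n)⁺ := by
      rw [inf_eq_sub_posPart_sub, sub_add_cancel]
    have hcd : 0 ≤ c • d n := nsmul_nonneg (hd n) c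
    have h2 : f n (x - c • d n)⁺ = 0 := by
      refine tendsto_nhds_unique (hlim n _ (posPart_nonneg _)) ?_
      have : ∀ k : ℕ, (x - c • d n)⁺ ⊓ k • (c • d n - x)⁺ = 0 := fun k => by
        refine inf_nsmul_eq_zero (posPart_nonneg _) (posPart_nonneg _) ?_ k
        rw [← neg_sub x, posPart_neg, posPart_inf_negPart_eq_zero]
      simp [this]
    have h3 := hvf n _ (posPart_nonneg (x - c • d n))
    have h4 := hvu n (x ⊓ c • d n) (le_inf hx hcd)
    have h5 : u (x ⊓ c • d n) ≤ u (c • d n) := apply_mono hu inf_le_right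
    rw [map_nsmul, nsmul_eq_mul] at h5
    rw [h1, map_add]
    linarith
  -- `r` is the part of `u` carried by `x`. Since `(c • d n - x)⁺ ≤ c • x`, only this part matters,
  -- and `r y - u (y ⊓ m • x)` bounds the loss from truncating `y` at `m • x`, uniformly in `n`.
  obtain ⟨r, -, -, hru, hrlim⟩ := exists_carried_part hu hx
  have hvy : ∀ n, ∀ y : E, 0 ≤ y → ∀ m : ℕ,
      (f n ⊓ u) y ≤ m * (c * u (d n)) + (r y - u (y ⊓ m • x)) := by
    intro n y hy m
    have hw : 0 ≤ (c • d n - x)⁺ := posPart_nonneg _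
    have hwx : (c • d n - x)⁺ ≤ c • x :=
      sup_le ((sub_le_self _ hx).trans (nsmul_le_nsmul_right (hdx n) c)) (nsmul_nonneg hx c)
    have hlim' : Tendsto (fun k : ℕ => m * (c * u (d n)) + (r y - u (y ⊓ m • x)) +
        (f n y - φ n (y ⊓ k • (c • d n - x)⁺))) atTop
        (𝓝 (m * (c * u (d n)) + (r y - u (y ⊓ m • x)) + (f n y - f n y))) :=
      tendsto_const_nhds.add (tendsto_const_nhds.sub (hlim n y hy))
    rw [sub_self, add_zero] at hlim'
    refine ge_of_tendsto' hlim' fun k => ?_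
    have hyk : 0 ≤ y ⊓ k • (c • d n - x)⁺ := le_inf hy (nsmul_nonneg hw k)
    have hK : y ⊓ k • (c • d n - x)⁺ ≤ y ⊓ (m + k * c) • x := by
      refine inf_le_inf_left y ((nsmul_le_nsmul_right hwx k).trans ?_)
      rw [← mul_nsmul']
      exact nsmul_le_nsmul_left hx (Nat.le_add_left _ _)
    have hm : y ⊓ m • x ≤ y ⊓ (m + k * c) • x :=
      inf_le_inf_left y (nsmul_le_nsmul_left hx (Nat.le_add_right _ _))
    have e1 := hvf n (y - y ⊓ k • (c • d n - x)⁺) (sub_nonneg.2 inf_le_left)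
    have e2 : φ n (y ⊓ k • (c • d n - x)⁺) ≤ f n (y ⊓ k • (c • d n - x)⁺) := by
      have := hle n _ hyk k
      rwa [inf_assoc, inf_idem] at this
    have e3 := apply_mono (hv n) hK
    have e4 := hvu n _ (sub_nonneg.2 hm)
    have e5 : (f n ⊓ u) (y ⊓ m • x) ≤ (f n ⊓ u) (m • x) := apply_mono (hv n) inf_le_right
    have e6 := hru y hy (m + k * c)
    have e7 : (m : ℝ) * (f n ⊓ u) x ≤ m * (c * u (d n)) :=
      mul_le_mul_of_nonneg_left (hvx n) m.cast_nonneg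
    rw [map_nsmul, nsmul_eq_mul] at e5
    rw [map_sub, map_sub] at e1 e4
    linarith
  have hpos : ∀ y : E, 0 ≤ y → Tendsto (fun n => (f n ⊓ u) y) atTop (𝓝 0) := by
    intro y hy
    rw [Metric.tendsto_atTop]
    intro ε hε
    have hm : Tendsto (fun m : ℕ => r y - u (y ⊓ m • x)) atTop (𝓝 0) := by
      simpa using (hrlim y hy).const_sub (r y)
    obtain ⟨m, hm⟩ := (hm.eventually_lt_const (half_pos hε)).exists
    have hn : Tendsto (fun n => m * (c * u (d n))) atTop (𝓝 0) := by
      simpa using (hud.const_mul (c : ℝ)).const_mul (m : ℝ)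
    obtain ⟨N, hN⟩ := eventually_atTop.1 (hn.eventually_lt_const (half_pos hε))
    refine ⟨N, fun n hn => ?_⟩
    rw [Real.dist_eq, sub_zero, abs_of_nonneg (apply_nonneg (hv n) hy)]
    have := hvy n y hy m
    have := hN n hn
    linarith
  intro y
  have := (hpos _ (posPart_nonneg y)).sub (hpos _ (negPart_nonneg y))
  simpa only [← map_sub, posPart_sub_negPart, sub_zero] using this

theorem UnboundedGrothendieckProperty.orderContinuous [CompleteSpace E]
    (hE : UnboundedGrothendieckProperty E) : OrderContinuous E := by
  refine orderContinuous_of_forall_sum_le fun x d ε hε hd hsum => ?_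
  by_contra! hdε
  have hx : 0 ≤ x := by simpa using hsum 0
  -- This size of `c` gives `‖c • d n‖ - ‖x‖ ≥ 1`.
  obtain ⟨c, hc⟩ := exists_nat_gt ((‖x‖ + 1) / ε)
  have hcε : ‖x‖ + 1 < c * ε := (div_lt_iff₀ hε).1 hc
  have hw : ∀ n, 0 ≤ (c • d n - x)⁺ := fun n => posPart_nonneg _
  have hw1 : ∀ n, 1 ≤ ‖(c • d n - x)⁺‖ := by
    intro n
    have h1 : ‖c • d n‖ ≤ ‖(c • d n - x)⁺ + x‖ :=
      norm_le_norm_of_nonneg_of_le (nsmul_nonneg (hd n) c)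
        (sub_le_iff_le_add.1 (le_posPart _))
    have h2 := norm_add_le (c • d n - x)⁺ x
    have h3 : ‖c • d n‖ = c * ‖d n‖ := by
      rw [← Nat.cast_smul_eq_nsmul ℝ, norm_smul]
      simp
    have h4 := mul_le_mul_of_nonneg_left (hdε n) (Nat.cast_nonneg (α := ℝ) c)
    linarith
  choose φ hφ hφ1 hφw using fun n => exists_dual_nonneg_norm_le (c • d n - x)⁺
  choose f hf hfφ hle hlim using fun n => exists_carried_part (hφ n) (hw n)
  have hnull := hE f ⟨1, fun n => (hfφ n).trans (hφ1 n)⟩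
    (unboundedWeakStarTendsto_of_carried hx hd hsum c hf hlim hle)
  have hge : ∀ n, 1 ≤ f n (c • x) := by
    intro n
    have h1 := hle n _ (hw n) 1
    rw [one_nsmul, inf_idem] at h1
    have hdx : d n ≤ x :=
      (Finset.single_le_sum (fun i _ => hd i) (Finset.self_mem_range_succ n)).trans (hsum (n + 1))
    have h2 : (c • d n - x)⁺ ≤ c • x :=
      sup_le ((sub_le_self _ hx).trans (nsmul_le_nsmul_right hdx c)) (nsmul_nonneg hx c)
    have h3 := apply_mono (hf n) h2
    have h4 := hφw n (hw n)
    have h5 := hw1 n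
    linarith
  have := ge_of_tendsto' (hnull.apply (c • x)) hge
  norm_num at this

/-! ### Order continuity makes bounded `uaw*`-null sequences weak* null. -/

/-- If the norm is order continuous, positive functionals are countably subadditive for
suprema of sequences of positive vectors. -/
theorem OrderContinuous.apply_isLUB_le (hE : OrderContinuous E) {g : StrongDual ℝ E}
    (hg : 0 ≤ g) {y : ℕ → E} (hy : ∀ j, 0 ≤ y j) {z : E} (hz : IsLUB (Set.range y) z)
    {b : ℕ → ℝ} {B : ℝ} (hb : ∀ j, g (y j) ≤ b j) (hB : HasSum b B) : g z ≤ B := by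
  have hb0 : ∀ j, 0 ≤ b j := fun j => (apply_nonneg hg (hy j)).trans (hb j)
  have hp : ∀ n, partialSups y n ≤ ∑ j ∈ Finset.range (n + 1), y j := fun n =>
    partialSups_le _ _ _ fun i hi =>
      Finset.single_le_sum (fun j _ => hy j) (Finset.mem_range.2 (Nat.lt_succ_of_le hi))
  have hgp : ∀ n, g (partialSups y n) ≤ B := fun n => by
    refine (apply_mono hg (hp n)).trans ?_
    rw [map_sum]
    exact (Finset.sum_le_sum fun j _ => hb j).trans (sum_le_hasSum _ (fun j _ => hb0 j) hB)
  have hglb : IsGLB (Set.range fun n => z - partialSups y n) 0 := by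
    constructor
    · rintro _ ⟨n, rfl⟩
      exact sub_nonneg.2 (partialSups_le _ _ _ fun i _ => hz.1 ⟨i, rfl⟩)
    · intro w hw
      have : z ≤ z - w := hz.2 (by
        rintro _ ⟨n, rfl⟩
        have h1 : w ≤ z - partialSups y n := hw ⟨n, rfl⟩
        exact (le_partialSups y n).trans (le_sub_comm.1 h1))
      exact le_sub_self_iff z |>.1 this
  have h0 := tendsto_zero_iff_norm_tendsto_zero.2 (hE.tendsto_norm
    (fun i j hij => sub_le_sub_left ((partialSups y).mono hij) z) hglb)
  have h1 := (g.continuous.tendsto 0).comp h0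
  rw [map_zero] at h1
  have h2 := h1.const_sub (g z)
  rw [sub_zero] at h2
  refine le_of_tendsto' h2 fun n => ?_
  simp only [Function.comp_apply, map_sub, sub_sub_cancel]
  exact hgp n

/-- An "almost disjoint" bounded sequence of positive functionals cannot stay away from zero at
vectors of an order interval. -/
theorem OrderContinuous.exists_apply_lt (hE : OrderContinuous E) (hσ : SigmaOrderComplete E)
    {g : ℕ → StrongDual ℝ E} (hg : ∀ n, 0 ≤ g n) {C : ℝ} (hC : ∀ n, ‖g n‖ ≤ C) {x : E}
    {y : ℕ → E} (hy : ∀ n, y n ∈ Set.Icc 0 x)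
    (hgy : ∀ i k, i < k → g i (y k) ≤ (1 / 2) ^ k) {ε : ℝ} (hε : 0 < ε) :
    ∃ n, g n (y n) < ε := by
  have hz : ∀ k, ∃ z, IsLUB (Set.range fun j => y (j + k)) z := fun k =>
    hσ _ (Set.countable_range _) (Set.range_nonempty _) ⟨x, by
      rintro _ ⟨j, rfl⟩
      exact (hy (j + k)).2⟩
  choose z hz using hz
  have hyz : ∀ k, y k ≤ z k := fun k => (hz k).1 ⟨0, by simp⟩
  have hz0 : ∀ k, 0 ≤ z k := fun k => (hy k).1.trans (hyz k)
  have hanti : Antitone z := antitone_nat_of_succ_le fun k => (hz (k + 1)).2 (by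
    rintro _ ⟨j, rfl⟩
    exact (hz k).1 ⟨j + 1, by simp only; congr 1; ring⟩)
  -- `l` is minus the infimum of the `z k`.
  obtain ⟨l, hl⟩ := hσ (Set.range fun k => -z k) (Set.countable_range _) (Set.range_nonempty _)
    ⟨0, by rintro _ ⟨k, rfl⟩; exact neg_nonpos.2 (hz0 k)⟩
  have hglb : IsGLB (Set.range fun k => z k + l) 0 := by
    constructor
    · rintro _ ⟨k, rfl⟩
      exact neg_le_iff_add_nonneg'.1 (hl.1 ⟨k, rfl⟩)
    · intro w hw
      have : l ≤ l - w := hl.2 (by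
        rintro _ ⟨k, rfl⟩
        have h1 : w ≤ z k + l := hw ⟨k, rfl⟩
        rw [neg_le_iff_add_nonneg, ← add_sub_right_comm, sub_nonneg, add_comm]
        exact h1)
      exact le_sub_self_iff l |>.1 this
  have hnorm := hE.tendsto_norm (a := fun k => z k + l)
    (fun i j hij => add_le_add_left (hanti hij) l) hglb
  -- Since `g i (z k) ≤ 2 * (1 / 2) ^ k` for `k > i`, `g i` is at most `0` at the infimum `-l`; thus
  -- `g n (z n) ≤ g n (z n + l)`.
  have hgl : ∀ i, 0 ≤ g i l := by
    intro i
    have hzk : ∀ k, i < k → g i (z k) ≤ 2 * (1 / 2) ^ k := by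
      intro k hk
      refine hE.apply_isLUB_le (hg i) (fun j => (hy _).1) (hz k)
        (b := fun j => (1 / 2) ^ j * (1 / 2) ^ k)
        (fun j => ?_) (hasSum_geometric_two.mul_right _)
      rw [← pow_add]
      exact hgy i (j + k) (by omega)
    have hlim : Tendsto (fun k : ℕ => -(2 * (1 / 2 : ℝ) ^ k)) atTop (𝓝 0) := by
      simpa using ((tendsto_pow_atTop_nhds_zero_of_lt_one (r := (1 / 2 : ℝ)) (by norm_num)
        (by norm_num)).const_mul 2).neg
    refine le_of_tendsto hlim ?_
    filter_upwards [eventually_gt_atTop i] with k hk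
    have h1 := hzk k hk
    have h2 := apply_mono (hg i) (hl.1 ⟨k, rfl⟩ : -z k ≤ l)
    rw [map_neg] at h2
    linarith
  have hCn : Tendsto (fun k => C * ‖z k + l‖) atTop (𝓝 0) := by
    simpa using hnorm.const_mul C
  obtain ⟨n, hn⟩ := (hCn.eventually_lt_const hε).exists
  refine ⟨n, lt_of_le_of_lt ?_ hn⟩
  have h1 := apply_mono (hg n) (hyz n)
  have h2 := hgl n
  have h3 := ((g n).le_opNorm (z n + l)).trans
    (mul_le_mul_of_nonneg_right (hC n) (norm_nonneg _))
  have h4 := Real.le_norm_self (g n (z n + l))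
  rw [map_add] at h3 h4
  linarith

/-- On a `σ`-order complete normed lattice with order continuous norm, bounded `uaw*`-null
sequences are weak* null. -/
theorem OrderContinuous.weakStarTendsto (hE : OrderContinuous E) (hσ : SigmaOrderComplete E)
    {f : ℕ → StrongDual ℝ E} {C : ℝ} (hC : ∀ n, ‖f n‖ ≤ C)
    (hf : UnboundedWeakStarTendsto f 0) : WeakStarTendsto f 0 := by
  have hpos : ∀ x : E, 0 ≤ x → Tendsto (fun n => |f n| x) atTop (𝓝 0) := by
    intro x hx
    by_contra hnot
    obtain ⟨ε, hε, hfreq⟩ : ∃ ε > 0, ∀ N, ∃ n ≥ N, ε ≤ |f n| x := by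
      rw [Metric.tendsto_atTop] at hnot
      push Not at hnot
      obtain ⟨ε, hε, h⟩ := hnot
      refine ⟨ε, hε, fun N => ?_⟩
      obtain ⟨n, hn, h⟩ := h N
      rw [Real.dist_eq, sub_zero, abs_of_nonneg (apply_nonneg (dual_abs_nonneg _) hx)] at h
      exact ⟨n, hn, h⟩
    -- Positivity of `u` sits inside the existentials so that `choose` gives functions of `k` and
    -- `u` alone, usable in the recursion below.
    have hstep : ∀ (k : ℕ) (u : StrongDual ℝ E), ∃ (n : ℕ) (y : E), 0 ≤ u →
        y ∈ Set.Icc 0 x ∧ ε / 2 ≤ |f n| y ∧ u y ≤ (1 / 2) ^ k := by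
      intro k u
      by_cases hu : 0 ≤ u
      swap
      · exact ⟨0, 0, fun h => absurd h hu⟩
      have h1 := weakStarTendsto_zero_iff.1 (hf u hu) x
      simp only [sub_zero] at h1
      have hδ : 0 < min (ε / 2) ((1 / 2) ^ k) := lt_min (half_pos hε) (by positivity)
      obtain ⟨N, hN⟩ := eventually_atTop.1 (h1.eventually_lt_const hδ)
      obtain ⟨n, hn, hεn⟩ := hfreq N
      -- Now `|f n| (x - y) + u y` is below both bounds, so `u y` is small and `|f n| y` retains at
      -- least `ε / 2` of `|f n| x ≥ ε`.
      obtain ⟨y, hy, hlt⟩ := exists_lt_of_inf_apply_lt hx (hN n hn)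
      have h2 := apply_nonneg (dual_abs_nonneg (f n)) (sub_nonneg.2 hy.2)
      have h3 := apply_nonneg hu hy.1
      have h4 := min_le_left (ε / 2) ((1 / 2 : ℝ) ^ k)
      have h5 := min_le_right (ε / 2) ((1 / 2 : ℝ) ^ k)
      rw [map_sub] at hlt h2
      exact ⟨n, y, fun _ => ⟨hy, by linarith, by linarith⟩⟩
    choose n y hny using hstep
    -- `u k` sums the moduli chosen before stage `k`, so smallness of `u k` at a positive vector
    -- passes to each of them.
    let u : ℕ → StrongDual ℝ E := fun k => Nat.rec 0 (fun j v => v + |f (n j v)|) k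
    have husucc : ∀ k, u (k + 1) = u k + |f (n k (u k))| := fun _ => rfl
    have hu : ∀ k, 0 ≤ u k := by
      intro k
      induction k with
      | zero => exact le_refl _
      | succ k ih =>
        intro w hw
        have h1 := apply_nonneg ih hw
        have h2 := apply_nonneg (dual_abs_nonneg (f (n k (u k)))) hw
        rw [husucc, add_apply, zero_apply]
        linarith
    have hle : ∀ i k, i < k → ∀ w : E, 0 ≤ w → |f (n i (u i))| w ≤ u k w := by
      intro i k hik w hw
      induction k, hik using Nat.le_induction with
      | base =>
        have h1 := apply_nonneg (hu i) hw
        rw [husucc, add_apply]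
        linarith
      | succ k _ ih =>
        have h2 := apply_nonneg (dual_abs_nonneg (f (n k (u k)))) hw
        rw [husucc, add_apply]
        linarith
    obtain ⟨m, hm⟩ := hE.exists_apply_lt hσ (g := fun k => |f (n k (u k))|)
      (fun k => dual_abs_nonneg _) (C := 3 * C)
      (fun k => (norm_dual_abs_le _).trans (by linarith [hC (n k (u k))]))
      (y := fun k => y k (u k)) (fun k => (hny k (u k) (hu k)).1)
      (fun i k hik => (hle i k hik _ (hny k (u k) (hu k)).1.1).trans (hny k (u k) (hu k)).2.2)
      (half_pos hε)
    exact absurd hm (not_lt.2 (hny m (u m) (hu m)).2.1)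
  rw [weakStarTendsto_zero_iff]
  intro x
  have hnn : ∀ x : E, 0 ≤ x → Tendsto (fun n => f n x) atTop (𝓝 0) := fun x hx =>
    squeeze_zero_norm (fun n => abs_apply_le (f n) hx) (hpos x hx)
  have := (hnn _ (posPart_nonneg x)).sub (hnn _ (negPart_nonneg x))
  simpa only [← map_sub, posPart_sub_negPart, sub_zero] using this

end Main

end BanachLattice

theorem mainTheorem6 (E : Type*) [NormedAddCommGroup E] [NormedSpace ℝ E] [CompleteSpace E]
    [Lattice E] [IsOrderedAddMonoid E] [IsOrderedModule ℝ E] [HasSolidNorm E]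
    (hE : BanachLattice.SigmaOrderComplete E)
    (hE' : BanachLattice.OrderContinuous (StrongDual ℝ E)) :
    BanachLattice.GrothendieckProperty E →
      (BanachLattice.UnboundedGrothendieckProperty E ↔ BanachLattice.OrderContinuous E) := fun hGP =>
  ⟨fun h => h.orderContinuous, fun h f ⟨_, hC⟩ hf => hGP f (h.weakStarTendsto hE hC hf)⟩
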